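/- For each $N\ge1$ let $U=U^{(N)}$ be a random $N\times N$ unitary matrix and $v=v^{(N)}$ a random unit vector in $\mathbb{C}^N$, defined on a common probability space. For $t\in\mathbb{R}$ put $G(t)=U\,(I_N-(1-t)vv^*)$, and let $$\omega_1^{(N)}=\sqrt N\,v^*U^*v,\qquad \mathscr{W}_2(z)=v^*(zU^*)^2(I_N-zU^*)^{-1}v\quad(|z|<1).$$ Write $D(z_0,r)$ for the open disc of centre $z_0$ and radius $r$, $\mathbb{D}=D(0,1)$ and $\overline{\mathbb{D}}$ for its closure. Events $E_N$ hold with high probability (w.h.p.) if $\mathbb{P}(E_N)\to1$, and with overwhelming probability if for every $A>0$, $1-\mathbb{P}(E_N)<N^{-A}$ for all large enough $N$. Assume: (Regularity of $\mathscr{W}_2$) for all $\delta,\epsilon'>0$, with overwhelming probability, $|\mathscr{W}_2(z)|\le N^{\epsilon'}\dfrac{|z|^2}{\sqrt N(1-|z|)}$ for all $z\in D(0,1-N^{-\delta})$ simultaneously; (Regularity of $\omega_1$) for every $\epsilon'>0$, w.h.p. $N^{\epsilon'}>|\omega_1^{(N)}|>N^{-\epsilon'}$. Then for any $\alpha>\epsilon>0$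 the following holds. 1. There is a strongly separated outlier at the origin for $|t|<N^{-1/2-\alpha}$: there are $\alpha_1<\alpha_2$ with $\alpha_1<0$ and $c_1,c_2\in(0,1)$ such that w.h.p., for every $t$ with $|t|<N^{-1/2-\alpha}$, exactly one eigenvalue of $G(t)$ lies in $D\!\left(0,c_1\frac{N^{\alpha_1}}{1+N^{\alpha_1}}\right)$ and $N-1$ eigenvalues lie in $\overline{\mathbb{D}}\setminus D\!\left(0,c_2\frac{N^{\alpha_2}}{1+N^{\alpha_2}}\right)$, eigenvalues being counted with algebraic multiplicity. 2. W.h.p., for all $t\in(-1,1)$ with $|t|>N^{-1/2+\alpha}$, every eigenvalue of $G(t)$ lies in $\overline{\mathbb{D}}\setminus D(0,1-N^{-\alpha+\epsilon})$. If moreover w.h.p. no eigenvector of $U$ is orthogonal to $v$ (in particular, if $U$ almost surely has simple spectrum and $v$ is independent of $U$ and has a density on the unit sphere), then 1 and 2 also hold with the open disc $\mathbb{D}$ in place of $\overline{\mathbb{D}}$. -/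

import Mathlib

open MeasureTheory Filter Topology
open scoped Matrix

noncomputable section

namespace UAModel

section Probability

variable {Ω : ℕ → Type*} [∀ N, MeasurableSpace (Ω N)]

/-- A sequence of events holds with high probability if its probability tends to `1`.
This is expressed through the complements, so that it also has the right meaning (up to an event
of small probability, the event holds) when `P N` is evaluated as an outer measure. -/
def WithHighProb (P : ∀ N, Measure (Ω N)) (E : ∀ N, Set (Ω N)) : Prop :=
  Tendsto (fun N => P N (E N)ᶜ) atTop (𝓝 0)

/-- A sequence of events holds with overwhelming probability if, for every `A > 0`, its complement
has probability less than `N ^ (-A)` for all large enough `N`. -/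
def WithOverwhelmingProb (P : ∀ N, Measure (Ω N)) (E : ∀ N, Set (Ω N)) : Prop :=
  ∀ A : ℝ, 0 < A → ∀ᶠ N : ℕ in atTop, P N (E N)ᶜ < ENNReal.ofReal ((N : ℝ) ^ (-A))

/-- `X` is stochastically dominated by `Y`, uniformly for `z ∈ S N`. -/
def StochDominated (P : ∀ N, Measure (Ω N)) (S : ℕ → Set ℂ) (X Y : ∀ N, Ω N → ℂ → ℂ) : Prop :=
  ∀ ε : ℝ, 0 < ε →
    WithOverwhelmingProb P (fun N => {ω | ∀ z ∈ S N, ‖X N ω z‖ ≤ (N : ℝ) ^ ε * ‖Y N ω z‖})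

end Probability

/-- The rank-one multiplicative perturbation `G(t) = U (I - (1 - t) v v^*)`. -/
def G {N : ℕ} (U : Matrix (Fin N) (Fin N) ℂ) (v : EuclideanSpace ℂ (Fin N)) (t : ℝ) :
    Matrix (Fin N) (Fin N) ℂ :=
  U * (1 - (1 - (t : ℂ)) • Matrix.vecMulVec v.ofLp (star v.ofLp))

/-- `ω₁ = √N v^* U^* v`. -/
def omega1 {N : ℕ} (U : Matrix (Fin N) (Fin N) ℂ) (v : EuclideanSpace ℂ (Fin N)) : ℂ :=
  (Real.sqrt N : ℂ) * (star v.ofLp ⬝ᵥ (Uᴴ *ᵥ v.ofLp))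

/-- `𝒲₂(z) = v^* (z U^*)² (I - z U^*)⁻¹ v`. The inverse exists for unitary `U` and `|z| < 1`. -/
def W2 {N : ℕ} (U : Matrix (Fin N) (Fin N) ℂ) (v : EuclideanSpace ℂ (Fin N)) (z : ℂ) : ℂ :=
  star v.ofLp ⬝ᵥ (((z • Uᴴ) ^ 2 * (1 - z • Uᴴ)⁻¹) *ᵥ v.ofLp)

/-- The number of eigenvalues of `M` in `S`, counted with algebraic multiplicity. -/
def eigCount {N : ℕ} (M : Matrix (Fin N) (Fin N) ℂ) (S : Set ℂ) : ℕ :=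
  open scoped Classical in Multiset.countP (· ∈ S) M.charpoly.roots

/-- No eigenvector of `U` is orthogonal to `v`. -/
def NoOrthogonalEigenvector {N : ℕ} (U : Matrix (Fin N) (Fin N) ℂ)
    (v : EuclideanSpace ℂ (Fin N)) : Prop :=
  ∀ (μ : ℂ) (x : Fin N → ℂ), x ≠ 0 → U *ᵥ x = μ • x → star v.ofLp ⬝ᵥ x ≠ 0

section Model

variable {Ω : ℕ → Type*} [∀ N, MeasurableSpace (Ω N)]

/-- Regularity of `𝒲₂`: for every `δ > 0`, `𝒲₂(z) ≺ |z|² / (√N (1 - |z|))` uniformly for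
`z ∈ D(0, 1 - N ^ (-δ))`. -/
def RegularW2 (P : ∀ N, Measure (Ω N)) (U : ∀ N, Ω N → Matrix (Fin N) (Fin N) ℂ)
    (v : ∀ N, Ω N → EuclideanSpace ℂ (Fin N)) : Prop :=
  ∀ δ : ℝ, 0 < δ →
    StochDominated P (fun N => Metric.ball (0 : ℂ) (1 - (N : ℝ) ^ (-δ)))
      (fun N ω z => W2 (U N ω) (v N ω) z)
      (fun N _ z => ((‖z‖ ^ 2 / (Real.sqrt N * (1 - ‖z‖)) : ℝ) : ℂ))

/-- Regularity of `ω₁`: for every `ε > 0`, `N ^ ε > |ω₁| > N ^ (-ε)` with high probability. -/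
def RegularOmega1 (P : ∀ N, Measure (Ω N)) (U : ∀ N, Ω N → Matrix (Fin N) (Fin N) ℂ)
    (v : ∀ N, Ω N → EuclideanSpace ℂ (Fin N)) : Prop :=
  ∀ ε : ℝ, 0 < ε →
    WithHighProb P (fun N => {ω | ‖omega1 (U N ω) (v N ω)‖ < (N : ℝ) ^ ε ∧
      (N : ℝ) ^ (-ε) < ‖omega1 (U N ω) (v N ω)‖})

/-- The matrices `M N ω t` have a strongly separated outlier at the origin for `t ∈ T N`, the other
`N - 1` eigenvalues lying in `𝒟` (the open or the closed unit disc). -/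
def StronglySeparatedOutlierAtOrigin (P : ∀ N, Measure (Ω N))
    (M : ∀ N, Ω N → ℝ → Matrix (Fin N) (Fin N) ℂ) (T : ℕ → Set ℝ) (𝒟 : Set ℂ) : Prop :=
  ∃ α₁ α₂ c₁ c₂ : ℝ, α₁ < α₂ ∧ α₁ < 0 ∧ 0 < c₁ ∧ c₁ < 1 ∧ 0 < c₂ ∧ c₂ < 1 ∧
    WithHighProb P (fun N => {ω | ∀ t ∈ T N,
      eigCount (M N ω t)
        (Metric.ball 0 (c₁ * ((N : ℝ) ^ α₁ / (1 + (N : ℝ) ^ α₁)))) = 1 ∧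
      eigCount (M N ω t)
        (𝒟 \ Metric.ball 0 (c₂ * ((N : ℝ) ^ α₂ / (1 + (N : ℝ) ^ α₂)))) + 1 = N})

end Model

end UAModel

end

/-! ### Counting roots in a disc by Jensen's formula. -/

section RootCount

open Polynomial Real

/-! Write `w = v^* U^* v`, so that `|ω₁| = √N |w|`. Since `G(t)` is a rank-one perturbation of `U`,
the matrix determinant lemma gives, for `|z| < 1`, `χ_G(z) = χ_U(z) * (t - (1 - t)(z w + 𝒲₂(z)))`
(`eval_charpoly_G`). As `χ_U` has no zero in the open disc, eigenvalues of `G(t)` there are governed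
by the scalar factor, in which `w` has size about `N ^ (-1/2)`.

If `|t|` is well above `N ^ (-1/2)`, then `t` dominates the factor on the whole disc of radius `1 -
N ^ (-α + ε)`, leaving no root there. If `|t|` is well below it, then `z w` dominates both `t` and
`𝒲₂(z)` on an annulus `r ≤ |z| ≤ R`. There `|χ_G|` agrees with `|1 - t| |w| |z| |χ_U|` up to a
factor 2, so no root lies in the annulus, and exactly one lies inside.

That count replaces Rouché's theorem by Jensen's formula: between radii `r` and `R`, the mean of
`log |χ_G|` grows by the number of inner roots times `log (R / r)`, while the comparison forces
growth `log (R / r)` up to `2 log 2`.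

That all eigenvalues lie in the closed or open unit disc follows separately from the norm identity
`norm_sq_eigenvalue_G`. -/

lemma circleAverage_log_norm_multiset_prod_X_sub_C (s : Multiset ℂ) {r : ℝ} (hr : r ≠ 0) :
    circleAverage (fun z => log ‖((s.map fun a => X - C a).prod).eval z‖) 0 r =
      (s.map fun a => log r + log⁺ (r⁻¹ * ‖a‖)).sum := by
  induction s using Multiset.induction_on with
  | empty => simp [circleAverage_const]
  | cons a s ih =>
    have hne : ((s.map fun a => X - C a).prod) ≠ 0 :=
      (monic_multiset_prod_of_monic s _ fun a _ => monic_X_sub_C a).ne_zero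
    have h1 : CircleIntegrable (fun z => log ‖z - a‖) 0 r :=
      circleIntegrable_log_norm_sub_const r
    have h2 : CircleIntegrable (fun z => log ‖((s.map fun a => X - C a).prod).eval z‖) 0 r :=
      (analyticOnNhd_id.aeval_polynomial _).meromorphicOn.circleIntegrable_log_norm
    rw [Multiset.map_cons (fun a => log r + log⁺ (r⁻¹ * ‖a‖)), Multiset.sum_cons, ← ih]
    have h3 := circleAverage_log_norm_sub_const_eq_log_radius_add_posLog (a := a) (c := 0) hr
    simp only [zero_sub, norm_neg] at h3
    rw [← h3, ← circleAverage_fun_add h1 h2]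
    -- `log |xy| = log |x| + log |y|` can fail at roots on the circle, because `log 0 = 0`; finitely
    -- many points do not affect the average.
    refine circleAverage_congr_codiscreteWithin ?_ hr
    have hfin : ((a ::ₘ s).toFinset : Set ℂ).Finite := Finset.finite_toSet _
    filter_upwards [compl_finite_mem_codiscreteWithin hfin] with z hz
    simp only [Multiset.mem_toFinset, Finset.mem_coe, Multiset.mem_cons, Set.mem_compl_iff,
      not_or] at hz
    rw [Multiset.map_cons, Multiset.prod_cons, eval_mul, norm_mul, log_mul]
    · simp
    · simpa [sub_eq_zero] using hz.1
    · rw [norm_ne_zero_iff]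
      intro h0
      have := (mem_roots hne).2 h0
      rw [roots_multiset_prod_X_sub_C] at this
      exact hz.2 this

open scoped Classical in
-- A root inside the smaller disc contributes `log R` and `log r` to the two averages; a root `a`
-- with `|a| ≥ R` contributes `log |a|` to both and cancels.
lemma circleAverage_log_norm_sub_circleAverage_log_norm {p : ℂ[X]} (hp : p.Monic) {r R : ℝ}
    (hr : 0 < r) (hrR : r < R) (h : ∀ z, r ≤ ‖z‖ → ‖z‖ < R → ¬ p.IsRoot z) :
    circleAverage (fun z => log ‖p.eval z‖) 0 R - circleAverage (fun z => log ‖p.eval z‖) 0 r =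
      p.roots.countP (· ∈ Metric.ball 0 r) * (log R - log r) := by
  have hprod : p = (p.roots.map fun a => X - C a).prod :=
    (IsAlgClosed.splits p).eq_prod_roots_of_monic hp
  have key : ∀ s : Multiset ℂ, (∀ a ∈ s, ‖a‖ < r ∨ R ≤ ‖a‖) →
      (s.map fun a => log R + log⁺ (R⁻¹ * ‖a‖)).sum - (s.map fun a => log r + log⁺ (r⁻¹ * ‖a‖)).sum
        = s.countP (· ∈ Metric.ball 0 r) * (log R - log r) := by
    intro s
    induction s using Multiset.induction_on with
    | empty => simp
    | cons a s ih =>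
      intro hs
      have ih' := ih fun b hb => hs b (Multiset.mem_cons_of_mem hb)
      have hR : 0 < R := hr.trans hrR
      simp only [Multiset.map_cons, Multiset.sum_cons, Multiset.countP_cons]
      rcases hs a (Multiset.mem_cons_self a s) with ha | ha
      · have e1 : log⁺ (R⁻¹ * ‖a‖) = 0 := by
          rw [posLog_eq_zero_iff, abs_of_nonneg (by positivity), inv_mul_le_iff₀ hR]; linarith
        have e2 : log⁺ (r⁻¹ * ‖a‖) = 0 := by
          rw [posLog_eq_zero_iff, abs_of_nonneg (by positivity), inv_mul_le_iff₀ hr]; linarith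
        have : a ∈ Metric.ball (0 : ℂ) r := by simpa using ha
        rw [e1, e2, if_pos this]; push_cast; linarith
      · have hapos : 0 < ‖a‖ := hR.trans_le ha
        have e1 : log⁺ (R⁻¹ * ‖a‖) = log ‖a‖ - log R := by
          rw [posLog_eq_log, log_mul (by positivity) (by positivity), log_inv]; · ring
          rw [abs_of_nonneg (by positivity), le_inv_mul_iff₀ hR]; linarith
        have e2 : log⁺ (r⁻¹ * ‖a‖) = log ‖a‖ - log r := by
          rw [posLog_eq_log, log_mul (by positivity) (by positivity), log_inv]; · ring
          rw [abs_of_nonneg (by positivity), le_inv_mul_iff₀ hr]; linarith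
        have : a ∉ Metric.ball (0 : ℂ) r := by simp; linarith
        rw [e1, e2, if_neg this]; push_cast; linarith
  rw [← key]
  · rw [← circleAverage_log_norm_multiset_prod_X_sub_C _ hr.ne',
      ← circleAverage_log_norm_multiset_prod_X_sub_C _ (hr.trans hrR).ne', ← hprod]
  · intro a ha
    by_contra! hc
    exact h a hc.1 hc.2 (isRoot_of_mem_roots ha)

lemma circleIntegrable_log_norm_eval (p : ℂ[X]) (c : ℂ) (r : ℝ) :
    CircleIntegrable (fun z => log ‖p.eval z‖) c r :=
  (analyticOnNhd_id.aeval_polynomial p).meromorphicOn.circleIntegrable_log_norm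

open scoped Classical in
/-- If a monic polynomial `p` is comparable to `c * z * q` on an annulus `r ≤ |z| ≤ R`, where `q` is
monic with no root in the disc of radius `R`, and the annulus is wide enough, then `p` has exactly
one root in the disc of radius `r`. -/
lemma countP_roots_ball_eq_one {p q : ℂ[X]} (hp : p.Monic) (hq : q.Monic) {r R c : ℝ}
    (hr : 0 < r) (hrR : 4 * r < R) (hc : 0 < c) (hq0 : ∀ z, ‖z‖ ≤ R → q.eval z ≠ 0)
    (hlow : ∀ z, r ≤ ‖z‖ → ‖z‖ ≤ R → c * ‖z‖ / 2 * ‖q.eval z‖ ≤ ‖p.eval z‖)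
    (hupp : ∀ z, r ≤ ‖z‖ → ‖z‖ ≤ R → ‖p.eval z‖ ≤ 2 * (c * ‖z‖) * ‖q.eval z‖) :
    p.roots.countP (· ∈ Metric.ball 0 r) = 1 := by
  have hR : 0 < R := by linarith
  have hrR' : r < R := by linarith
  have hp0 : ∀ z, r ≤ ‖z‖ → ‖z‖ ≤ R → 0 < ‖p.eval z‖ := fun z h1 h2 => by
    refine lt_of_lt_of_le ?_ (hlow z h1 h2)
    have := norm_pos_iff.2 (hq0 z h2)
    have := hr.trans_le h1
    positivity
  have Hp := circleAverage_log_norm_sub_circleAverage_log_norm hp hr hrR'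
    (fun z h1 h2 h => by simpa [h.eq_zero] using hp0 z h1 h2.le)
  have Hq := circleAverage_log_norm_sub_circleAverage_log_norm hq hr hrR'
    (fun z _ h2 h => hq0 z h2.le h)
  have Hq0 : q.roots.countP (· ∈ Metric.ball 0 r) = 0 := by
    rw [Multiset.countP_eq_zero]
    intro a ha hb
    refine hq0 a ?_ (isRoot_of_mem_roots ha)
    have : ‖a‖ < r := by simpa using hb
    linarith
  rw [Hq0, Nat.cast_zero, zero_mul] at Hq
  have bound : ∀ ρ, r ≤ ρ → ρ ≤ R →
      log (c / 2) + log ρ ≤ circleAverage (fun z => log ‖p.eval z‖) 0 ρ -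
          circleAverage (fun z => log ‖q.eval z‖) 0 ρ ∧
      circleAverage (fun z => log ‖p.eval z‖) 0 ρ - circleAverage (fun z => log ‖q.eval z‖) 0 ρ
        ≤ log (2 * c) + log ρ := by
    intro ρ h1 h2
    have hρ : 0 < ρ := hr.trans_le h1
    rw [← circleAverage_fun_sub (circleIntegrable_log_norm_eval p 0 ρ)
      (circleIntegrable_log_norm_eval q 0 ρ)]
    have hint : CircleIntegrable (fun z => log ‖p.eval z‖ - log ‖q.eval z‖) 0 ρ :=
      (circleIntegrable_log_norm_eval p 0 ρ).sub (circleIntegrable_log_norm_eval q 0 ρ)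
    constructor
    · rw [← circleAverage_const (log (c / 2) + log ρ) 0 ρ]
      refine circleAverage_mono (circleIntegrable_const _ _ _) hint fun z hz => ?_
      have hz' : ‖z‖ = ρ := by simpa [abs_of_pos hρ] using hz
      have hqz := norm_pos_iff.2 (hq0 z (hz'.trans_le h2))
      have := log_le_log (by rw [hz']; positivity) (hlow z (hz'.symm ▸ h1) (hz'.symm ▸ h2))
      rw [hz', log_mul (by positivity) (by positivity), show c * ρ / 2 = c / 2 * ρ by ring,
        log_mul (by positivity) (by positivity)] at this
      linarith
    · refine circleAverage_mono_on_of_le_circle hint fun z hz => ?_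
      have hz' : ‖z‖ = ρ := by simpa [abs_of_pos hρ] using hz
      have hqz := norm_pos_iff.2 (hq0 z (hz'.trans_le h2))
      have := log_le_log (hp0 z (hz'.symm ▸ h1) (hz'.symm ▸ h2))
        (hupp z (hz'.symm ▸ h1) (hz'.symm ▸ h2))
      rw [hz', log_mul (by positivity) (by positivity), show 2 * (c * ρ) = 2 * c * ρ by ring,
        log_mul (by positivity) (by positivity)] at this
      linarith
  obtain ⟨b1, b2⟩ := bound r le_rfl hrR'.le
  obtain ⟨b3, b4⟩ := bound R hrR'.le le_rfl
  rw [log_div hc.ne' two_ne_zero] at b1 b3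
  rw [log_mul two_ne_zero hc.ne'] at b2 b4
  -- The bounds at the two radii give `|k - 1| * log (R / r) ≤ 2 log 2` for the root count `k`, so
  -- `R > 4 r` forces `k = 1`.
  have hL : 2 * log 2 < log R - log r := by
    have := log_lt_log (by positivity) hrR
    rw [log_mul (by norm_num) hr.ne', show (4 : ℝ) = 2 ^ 2 by norm_num, log_pow] at this
    push_cast at this
    linarith
  have hlog2 : 0 < log 2 := log_pos (by norm_num)
  set k := p.roots.countP (· ∈ Metric.ball 0 r)
  rcases Nat.lt_trichotomy k 1 with hk | hk | hk
  · have : k = 0 := by omega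
    rw [this] at Hp
    push_cast at Hp
    linarith
  · exact hk
  · have : (2 : ℝ) ≤ k := by exact_mod_cast hk
    nlinarith

end RootCount

/-! ### Eigenvalues and characteristic polynomial of the rank-one perturbation. -/

namespace UAModel

variable {N : ℕ} {U : Matrix (Fin N) (Fin N) ℂ} {v : EuclideanSpace ℂ (Fin N)}

lemma star_dotProduct_self_eq_norm_sq (x : Fin N → ℂ) :
    star x ⬝ᵥ x = ((‖WithLp.toLp 2 x‖ ^ 2 : ℝ) : ℂ) := by
  rw [EuclideanSpace.norm_sq_eq]
  simp [dotProduct, Complex.conj_mul']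

lemma isRoot_charpoly_iff (M : Matrix (Fin N) (Fin N) ℂ) (z : ℂ) :
    M.charpoly.IsRoot z ↔ ∃ x ≠ 0, M *ᵥ x = z • x := by
  rw [Polynomial.IsRoot, Matrix.eval_charpoly, ← Matrix.exists_mulVec_eq_zero_iff]
  refine exists_congr fun x => and_congr_right fun _ => ?_
  rw [Matrix.sub_mulVec, sub_eq_zero, eq_comm]
  simp [Matrix.scalar_apply, ← Matrix.smul_one_eq_diagonal, Matrix.smul_mulVec]

lemma G_mulVec (U : Matrix (Fin N) (Fin N) ℂ) (v : EuclideanSpace ℂ (Fin N)) (t : ℝ)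
    (x : Fin N → ℂ) :
    G U v t *ᵥ x = U *ᵥ (x - ((1 - (t : ℂ)) * (star v.ofLp ⬝ᵥ x)) • v.ofLp) := by
  rw [G, ← Matrix.mulVec_mulVec, Matrix.sub_mulVec, Matrix.one_mulVec, Matrix.smul_mulVec,
    Matrix.vecMulVec_mulVec, mul_smul]
  simp

lemma star_mulVec_dotProduct_mulVec_of_mem_unitaryGroup
    (hU : U ∈ Matrix.unitaryGroup (Fin N) ℂ) (x : Fin N → ℂ) :
    star (U *ᵥ x) ⬝ᵥ (U *ᵥ x) = star x ⬝ᵥ x := by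
  rw [Matrix.star_mulVec, Matrix.dotProduct_mulVec, Matrix.vecMul_vecMul,
    ← Matrix.star_eq_conjTranspose, Matrix.mem_unitaryGroup_iff'.1 hU, Matrix.vecMul_one]

lemma norm_sq_G_mulVec (hU : U ∈ Matrix.unitaryGroup (Fin N) ℂ)
    (hv : star v.ofLp ⬝ᵥ v.ofLp = 1) (t : ℝ) (x : Fin N → ℂ) :
    ‖WithLp.toLp 2 (G U v t *ᵥ x)‖ ^ 2 =
      ‖WithLp.toLp 2 x‖ ^ 2 - (1 - t ^ 2) * ‖star v.ofLp ⬝ᵥ x‖ ^ 2 := by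
  have h : ((‖WithLp.toLp 2 (G U v t *ᵥ x)‖ ^ 2 : ℝ) : ℂ) =
      ((‖WithLp.toLp 2 x‖ ^ 2 - (1 - t ^ 2) * ‖star v.ofLp ⬝ᵥ x‖ ^ 2 : ℝ) : ℂ) := by
    rw [Complex.ofReal_sub, ← star_dotProduct_self_eq_norm_sq, ← star_dotProduct_self_eq_norm_sq,
      G_mulVec, star_mulVec_dotProduct_mulVec_of_mem_unitaryGroup hU]
    have e : star x ⬝ᵥ v.ofLp = star (star v.ofLp ⬝ᵥ x) := by
      rw [Matrix.star_dotProduct]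
    set a := star v.ofLp ⬝ᵥ x
    have ea : star a * a = ((‖a‖ ^ 2 : ℝ) : ℂ) := by simp [Complex.conj_mul']
    push_cast at ea ⊢
    rw [← ea]
    simp only [star_sub, star_smul, sub_dotProduct, dotProduct_sub, smul_dotProduct,
      dotProduct_smul, smul_eq_mul, star_mul', hv, e, star_one]
    have : star (t : ℂ) = t := Complex.conj_ofReal t
    rw [this, show star v.ofLp ⬝ᵥ x = a from rfl]
    ring
  exact_mod_cast h

/-- The eigenvalue equation: an eigenvalue of `G(t)` is contracting, by an amount determined by the
component of the eigenvector along `v`. -/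
lemma norm_sq_eigenvalue_G (hU : U ∈ Matrix.unitaryGroup (Fin N) ℂ)
    (hv : star v.ofLp ⬝ᵥ v.ofLp = 1) {t : ℝ} {x : Fin N → ℂ} {z : ℂ}
    (hz : G U v t *ᵥ x = z • x) :
    ‖z‖ ^ 2 * ‖WithLp.toLp 2 x‖ ^ 2 =
      ‖WithLp.toLp 2 x‖ ^ 2 - (1 - t ^ 2) * ‖star v.ofLp ⬝ᵥ x‖ ^ 2 := by
  rw [← norm_sq_G_mulVec hU hv, hz, WithLp.toLp_smul, norm_smul, mul_pow]

lemma mem_closedBall_of_isRoot_charpoly_G (hU : U ∈ Matrix.unitaryGroup (Fin N) ℂ)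
    (hv : star v.ofLp ⬝ᵥ v.ofLp = 1) {t : ℝ} (ht : |t| ≤ 1) {z : ℂ}
    (hz : (G U v t).charpoly.IsRoot z) : z ∈ Metric.closedBall (0 : ℂ) 1 := by
  obtain ⟨x, hx, hxz⟩ := (isRoot_charpoly_iff _ z).1 hz
  have h := norm_sq_eigenvalue_G hU hv hxz
  have hx' : 0 < ‖WithLp.toLp 2 x‖ := norm_pos_iff.2 (by simpa using hx)
  have ht2 : 0 ≤ 1 - t ^ 2 := by nlinarith [abs_nonneg t, sq_abs t]
  rw [mem_closedBall_zero_iff]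
  by_contra! hc
  have : 0 ≤ (1 - t ^ 2) * ‖star v.ofLp ⬝ᵥ x‖ ^ 2 := by positivity
  have : 0 < (‖z‖ ^ 2 - 1) * ‖WithLp.toLp 2 x‖ ^ 2 :=
    mul_pos (by nlinarith) (by positivity)
  linarith

/-- Contraction is strict unless `v^* x = 0`; but then `G(t) x = U x`, so `x` would be an
eigenvector of `U` orthogonal to `v`. -/
lemma mem_ball_of_isRoot_charpoly_G (hU : U ∈ Matrix.unitaryGroup (Fin N) ℂ)
    (hv : star v.ofLp ⬝ᵥ v.ofLp = 1) (hUv : NoOrthogonalEigenvector U v) {t : ℝ} (ht : |t| < 1)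
    {z : ℂ} (hz : (G U v t).charpoly.IsRoot z) : z ∈ Metric.ball (0 : ℂ) 1 := by
  obtain ⟨x, hx, hxz⟩ := (isRoot_charpoly_iff _ z).1 hz
  have h := norm_sq_eigenvalue_G hU hv hxz
  have hx' : 0 < ‖WithLp.toLp 2 x‖ := norm_pos_iff.2 (by simpa using hx)
  have ht2 : 0 < 1 - t ^ 2 := by nlinarith [abs_nonneg t, sq_abs t]
  have hvx : star v.ofLp ⬝ᵥ x ≠ 0 := by
    intro h0
    rw [G_mulVec, h0, mul_zero, zero_smul, sub_zero] at hxz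
    exact hUv z x hx hxz h0
  have hvx' := norm_pos_iff.2 hvx
  rw [mem_ball_zero_iff]
  by_contra! hc
  have : 0 < (1 - t ^ 2) * ‖star v.ofLp ⬝ᵥ x‖ ^ 2 := by positivity
  have : 0 ≤ (‖z‖ ^ 2 - 1) * ‖WithLp.toLp 2 x‖ ^ 2 :=
    mul_nonneg (by nlinarith) (by positivity)
  linarith

lemma eval_charpoly_ne_zero_of_mem_unitaryGroup (hU : U ∈ Matrix.unitaryGroup (Fin N) ℂ) {z : ℂ}
    (hz : ‖z‖ < 1) : U.charpoly.eval z ≠ 0 := by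
  intro h
  obtain ⟨x, hx, hxz⟩ := (isRoot_charpoly_iff _ z).1 h
  have hx' : 0 < ‖WithLp.toLp 2 x‖ := norm_pos_iff.2 (by simpa using hx)
  have e := star_mulVec_dotProduct_mulVec_of_mem_unitaryGroup hU x
  rw [star_dotProduct_self_eq_norm_sq, star_dotProduct_self_eq_norm_sq, hxz, WithLp.toLp_smul,
    norm_smul, mul_pow] at e
  have e' : ‖z‖ ^ 2 * ‖WithLp.toLp 2 x‖ ^ 2 = ‖WithLp.toLp 2 x‖ ^ 2 := by exact_mod_cast e
  have : 0 < (1 - ‖z‖ ^ 2) * ‖WithLp.toLp 2 x‖ ^ 2 :=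
    mul_pos (by nlinarith [norm_nonneg z]) (by positivity)
  linarith

lemma eval_charpoly_of_mem_unitaryGroup (hU : U ∈ Matrix.unitaryGroup (Fin N) ℂ) (z : ℂ) :
    U.charpoly.eval z = (-U).det * (1 - z • Uᴴ).det := by
  have h : U * Uᴴ = 1 := Matrix.mem_unitaryGroup_iff.1 hU
  rw [Matrix.eval_charpoly, ← Matrix.det_mul, Matrix.mul_sub, Matrix.mul_smul,
    Matrix.neg_mul _ Uᴴ, h]
  congr 1
  simp [Matrix.scalar_apply, ← Matrix.smul_one_eq_diagonal]
  abel

lemma isUnit_det_one_sub_smul_conjTranspose (hU : U ∈ Matrix.unitaryGroup (Fin N) ℂ) {z : ℂ}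
    (hz : ‖z‖ < 1) : IsUnit (1 - z • Uᴴ).det := by
  have h := eval_charpoly_ne_zero_of_mem_unitaryGroup hU hz
  rw [eval_charpoly_of_mem_unitaryGroup hU] at h
  exact isUnit_iff_ne_zero.2 (right_ne_zero_of_mul h)

/-- The Neumann series is cut after two terms; `W2` is the exact remainder. -/
lemma star_dotProduct_resolvent_mulVec (hU : U ∈ Matrix.unitaryGroup (Fin N) ℂ)
    (hv : star v.ofLp ⬝ᵥ v.ofLp = 1) {z : ℂ} (hz : ‖z‖ < 1) :
    star v.ofLp ⬝ᵥ ((1 - z • Uᴴ)⁻¹ *ᵥ v.ofLp) =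
      1 + z * (star v.ofLp ⬝ᵥ (Uᴴ *ᵥ v.ofLp)) + W2 U v z := by
  have h := Matrix.mul_nonsing_inv _ (isUnit_det_one_sub_smul_conjTranspose hU hz)
  have e : (1 - z • Uᴴ)⁻¹ = 1 + z • Uᴴ + (z • Uᴴ) ^ 2 * (1 - z • Uᴴ)⁻¹ := by
    set B := z • Uᴴ
    calc (1 - B)⁻¹ = (1 + B) * ((1 - B) * (1 - B)⁻¹) + B ^ 2 * (1 - B)⁻¹ := by noncomm_ring
      _ = _ := by rw [h, mul_one]
  conv_lhs => rw [e]
  rw [W2, Matrix.add_mulVec, Matrix.add_mulVec, Matrix.one_mulVec, Matrix.smul_mulVec,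
    dotProduct_add, dotProduct_add, dotProduct_smul, hv, smul_eq_mul]

/-- The characteristic polynomial of `G(t)` in the unit disc. -/
lemma eval_charpoly_G (hU : U ∈ Matrix.unitaryGroup (Fin N) ℂ)
    (hv : star v.ofLp ⬝ᵥ v.ofLp = 1) (t : ℝ) {z : ℂ} (hz : ‖z‖ < 1) :
    (G U v t).charpoly.eval z = U.charpoly.eval z *
      (t - (1 - t) * (z * (star v.ofLp ⬝ᵥ (Uᴴ *ᵥ v.ofLp)) + W2 U v z)) := by
  have h : U * Uᴴ = 1 := Matrix.mem_unitaryGroup_iff.1 hU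
  have hA := isUnit_det_one_sub_smul_conjTranspose hU hz
  -- Factoring out `-U` leaves a rank-one update of `1 - z • Uᴴ`, ready for the matrix determinant
  -- lemma.
  have e : Matrix.scalar (Fin N) z - G U v t = -U * ((1 - z • Uᴴ) +
      Matrix.replicateCol Unit (-(1 - (t : ℂ)) • v.ofLp) *
        Matrix.replicateRow Unit (star v.ofLp)) := by
    rw [← Matrix.vecMulVec_eq, Matrix.smul_vecMulVec, G, Matrix.mul_add, Matrix.mul_sub,
      Matrix.mul_sub, Matrix.mul_smul, Matrix.mul_smul, Matrix.neg_mul _ Uᴴ, h, Matrix.mul_smul]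
    simp [Matrix.scalar_apply, ← Matrix.smul_one_eq_diagonal]
    module
  rw [Matrix.eval_charpoly, e, Matrix.det_mul, Matrix.det_add_replicateCol_mul_replicateRow hA,
    eval_charpoly_of_mem_unitaryGroup hU, mul_assoc,
    Matrix.det_unique (n := Unit)]
  have e2 : (Matrix.replicateRow Unit (star v.ofLp) * (1 - z • Uᴴ)⁻¹ *
      Matrix.replicateCol Unit (-(1 - (t : ℂ)) • v.ofLp)) default default =
      -(1 - (t : ℂ)) * (star v.ofLp ⬝ᵥ ((1 - z • Uᴴ)⁻¹ *ᵥ v.ofLp)) := by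
    rw [Matrix.mul_assoc, ← Matrix.replicateCol_mulVec,
      Matrix.replicateRow_mul_replicateCol_apply, Matrix.mulVec_smul, dotProduct_smul, smul_eq_mul]
  rw [Matrix.add_apply, Matrix.one_apply_eq, e2, star_dotProduct_resolvent_mulVec hU hv hz]
  ring

lemma not_isRoot_charpoly_G (hU : U ∈ Matrix.unitaryGroup (Fin N) ℂ)
    (hv : star v.ofLp ⬝ᵥ v.ofLp = 1) {t : ℝ} (ht : |t| ≤ 1) {z : ℂ} (hz : ‖z‖ < 1)
    (h : 2 * (‖star v.ofLp ⬝ᵥ (Uᴴ *ᵥ v.ofLp)‖ + ‖W2 U v z‖) < |t|) :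
    ¬ (G U v t).charpoly.IsRoot z := by
  intro h0
  rw [Polynomial.IsRoot, eval_charpoly_G hU hv t hz, mul_eq_zero,
    or_iff_right (eval_charpoly_ne_zero_of_mem_unitaryGroup hU hz), sub_eq_zero] at h0
  have h1 := congrArg norm h0
  rw [norm_mul, Complex.norm_real, Real.norm_eq_abs] at h1
  have h2 : ‖(1 : ℂ) - t‖ ≤ 2 := (norm_sub_le _ _).trans (by simpa using by linarith)
  have h3 := norm_add_le (z * (star v.ofLp ⬝ᵥ (Uᴴ *ᵥ v.ofLp))) (W2 U v z)
  rw [norm_mul] at h3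
  have h4 := mul_le_of_le_one_left (norm_nonneg (star v.ofLp ⬝ᵥ (Uᴴ *ᵥ v.ofLp))) hz.le
  have h5 := mul_le_mul h2 h3 (norm_nonneg _) zero_le_two
  linarith

/-- A criterion for a strongly separated outlier at the origin. -/
lemma eigCount_G_of_annulus (hU : U ∈ Matrix.unitaryGroup (Fin N) ℂ)
    (hv : star v.ofLp ⬝ᵥ v.ofLp = 1) {t r R : ℝ} (ht : |t| ≤ 1 / 2) (hr : 0 < r)
    (hrR : 4 * r < R) (hR : R < 1) (hw : star v.ofLp ⬝ᵥ (Uᴴ *ᵥ v.ofLp) ≠ 0)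
    (htw : 8 * |t| ≤ ‖star v.ofLp ⬝ᵥ (Uᴴ *ᵥ v.ofLp)‖ * r)
    (hW : ∀ z, ‖z‖ ≤ R → ‖W2 U v z‖ ≤ ‖star v.ofLp ⬝ᵥ (Uᴴ *ᵥ v.ofLp)‖ * ‖z‖ / 4)
    {𝒟 : Set ℂ} (h𝒟 : ∀ z, (G U v t).charpoly.IsRoot z → z ∈ 𝒟) :
    eigCount (G U v t) (Metric.ball 0 r) = 1 ∧
      eigCount (G U v t) (𝒟 \ Metric.ball 0 R) + 1 = N := by
  classical
  set w := star v.ofLp ⬝ᵥ (Uᴴ *ᵥ v.ofLp) with hwdef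
  have hw' : 0 < ‖w‖ := norm_pos_iff.2 hw
  have ht1 : 1 / 2 ≤ ‖(1 : ℂ) - t‖ := by
    have h1 := norm_sub_norm_le (1 : ℂ) t
    rw [norm_one, Complex.norm_real, Real.norm_eq_abs] at h1
    linarith
  have hc : 0 < ‖(1 : ℂ) - t‖ * ‖w‖ := by positivity
  have hq0 : ∀ z : ℂ, ‖z‖ ≤ R → U.charpoly.eval z ≠ 0 := fun z hz =>
    eval_charpoly_ne_zero_of_mem_unitaryGroup hU (hz.trans_lt hR)
  -- `t` and `𝒲₂` each use at most a quarter of the main term; for `t`, this combines `8 |t| ≤ |w|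
  -- r` with `|1 - t| ≥ 1/2`.
  have herr : ∀ z : ℂ, r ≤ ‖z‖ → ‖z‖ ≤ R →
      ‖(t : ℂ) - (1 - t) * W2 U v z‖ ≤ ‖(1 : ℂ) - t‖ * ‖w‖ * ‖z‖ / 2 := by
    intro z h1 h2
    have h3 := norm_sub_le (t : ℂ) ((1 - t) * W2 U v z)
    rw [norm_mul, Complex.norm_real, Real.norm_eq_abs] at h3
    have h4 := mul_le_mul_of_nonneg_left (hW z h2) (norm_nonneg ((1 : ℂ) - t))
    have h5 := mul_le_mul_of_nonneg_left h1 hw'.le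
    have h6 := mul_le_mul_of_nonneg_right ht1 (by positivity : 0 ≤ ‖w‖ * ‖z‖)
    linarith
  have hmain : ∀ z : ℂ, ‖(1 - (t : ℂ)) * (z * w)‖ = ‖(1 : ℂ) - t‖ * ‖w‖ * ‖z‖ := fun z => by
    rw [norm_mul, norm_mul]; ring
  have hfac : ∀ z : ℂ, (t : ℂ) - (1 - t) * (z * w + W2 U v z) =
      ((t : ℂ) - (1 - t) * W2 U v z) - (1 - (t : ℂ)) * (z * w) := fun z => by ring
  have hlow : ∀ z : ℂ, r ≤ ‖z‖ → ‖z‖ ≤ R →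
      ‖(1 : ℂ) - t‖ * ‖w‖ * ‖z‖ / 2 * ‖U.charpoly.eval z‖ ≤ ‖(G U v t).charpoly.eval z‖ := by
    intro z h1 h2
    rw [eval_charpoly_G hU hv t (h2.trans_lt hR), norm_mul, mul_comm, hfac]
    refine mul_le_mul_of_nonneg_left ?_ (norm_nonneg _)
    have h3 := norm_sub_norm_le ((1 - (t : ℂ)) * (z * w)) ((t : ℂ) - (1 - t) * W2 U v z)
    rw [hmain, norm_sub_rev ((1 - (t : ℂ)) * (z * w))] at h3
    linarith [herr z h1 h2]
  have hupp : ∀ z : ℂ, r ≤ ‖z‖ → ‖z‖ ≤ R → ‖(G U v t).charpoly.eval z‖ ≤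
      2 * (‖(1 : ℂ) - t‖ * ‖w‖ * ‖z‖) * ‖U.charpoly.eval z‖ := by
    intro z h1 h2
    rw [eval_charpoly_G hU hv t (h2.trans_lt hR), norm_mul, mul_comm, hfac]
    refine mul_le_mul_of_nonneg_right ?_ (norm_nonneg _)
    have h3 := norm_sub_le ((t : ℂ) - (1 - t) * W2 U v z) ((1 - (t : ℂ)) * (z * w))
    rw [hmain] at h3
    have := herr z h1 h2
    have : 0 ≤ ‖(1 : ℂ) - t‖ * ‖w‖ * ‖z‖ := by positivity
    linarith
  have hone := countP_roots_ball_eq_one (Matrix.charpoly_monic (G U v t))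
    (Matrix.charpoly_monic U) hr hrR hc hq0 hlow hupp
  refine ⟨by rw [eigCount]; convert hone, ?_⟩
  have hcard : Multiset.card (G U v t).charpoly.roots = N := by
    rw [← (IsAlgClosed.splits (G U v t).charpoly).natDegree_eq_card_roots,
      Matrix.charpoly_natDegree_eq_dim, Fintype.card_fin]
  have hsplit := Multiset.card_eq_countP_add_countP (· ∈ Metric.ball (0 : ℂ) r)
    (G U v t).charpoly.roots
  rw [hone, hcard] at hsplit
  -- The lower bound `hlow` excludes roots from the annulus, so lying outside radius `r` and lying
  -- outside radius `R` are the same for roots.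
  have hcongr : Multiset.countP (· ∈ 𝒟 \ Metric.ball (0 : ℂ) R) (G U v t).charpoly.roots =
      Multiset.countP (fun a => a ∉ Metric.ball (0 : ℂ) r) (G U v t).charpoly.roots := by
    refine Multiset.countP_congr rfl fun z hz => ?_
    have hroot := Polynomial.isRoot_of_mem_roots hz
    simp only [Set.mem_sdiff, h𝒟 z hroot, true_and, mem_ball_zero_iff, not_lt, eq_iff_iff]
    refine ⟨fun h => by linarith, fun h => ?_⟩
    by_contra! hc'
    have h1 := hlow z h hc'.le
    rw [hroot.eq_zero, norm_zero] at h1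
    have h2 := norm_pos_iff.2 (hq0 z hc'.le)
    have h3 : 0 < ‖z‖ := hr.trans_le h
    exact absurd h1 (not_le.2 (by positivity))
  have : eigCount (G U v t) (𝒟 \ Metric.ball 0 R) =
      Multiset.countP (· ∈ 𝒟 \ Metric.ball (0 : ℂ) R) (G U v t).charpoly.roots := by
    rw [eigCount]; convert rfl
  rw [this, hcongr]
  omega

end UAModel

/-! ### Calculus of high-probability events. -/

namespace UAModel

section Events

variable {Ω : ℕ → Type*} [∀ N, MeasurableSpace (Ω N)] {P : ∀ N, Measure (Ω N)}
  {E F : ∀ N, Set (Ω N)}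

lemma WithHighProb.mono (hE : WithHighProb P E) (h : ∀ᶠ N in atTop, E N ⊆ F N) :
    WithHighProb P F :=
  tendsto_of_tendsto_of_tendsto_of_le_of_le' tendsto_const_nhds hE
    (Eventually.of_forall fun _ => zero_le)
    (h.mono fun _ hN => measure_mono (Set.compl_subset_compl.2 hN))

lemma WithHighProb.inter (hE : WithHighProb P E) (hF : WithHighProb P F) :
    WithHighProb P (fun N => E N ∩ F N) := by
  have h : Tendsto (fun N => P N (E N)ᶜ + P N (F N)ᶜ) atTop (𝓝 0) := by
    simpa using Tendsto.add hE hF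
  refine tendsto_of_tendsto_of_tendsto_of_le_of_le tendsto_const_nhds h (fun _ => zero_le)
    fun N => ?_
  rw [Set.compl_inter]
  exact measure_union_le _ _

lemma withHighProb_univ : WithHighProb P (fun _ => Set.univ) := by
  simp [WithHighProb]

lemma WithOverwhelmingProb.withHighProb (hE : WithOverwhelmingProb P E) : WithHighProb P E := by
  have h : Tendsto (fun N : ℕ => ENNReal.ofReal ((N : ℝ) ^ (-(1 : ℝ)))) atTop (𝓝 0) := by
    rw [← ENNReal.ofReal_zero]
    exact ENNReal.tendsto_ofReal
      ((tendsto_rpow_neg_atTop one_pos).comp tendsto_natCast_atTop_atTop)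
  exact tendsto_of_tendsto_of_tendsto_of_le_of_le' tendsto_const_nhds h
    (Eventually.of_forall fun _ => zero_le) ((hE 1 one_pos).mono fun _ hN => hN.le)

end Events

lemma eventually_natCast_rpow_neg_lt {a b : ℝ} (ha : 0 < a) (hb : 0 < b) :
    ∀ᶠ N : ℕ in atTop, (N : ℝ) ^ (-a) < b :=
  ((tendsto_rpow_neg_atTop ha).comp tendsto_natCast_atTop_atTop).eventually_lt_const hb

/-! ### Deterministic estimates on the regularity events. -/

section Deterministic

variable {N : ℕ} {U : Matrix (Fin N) (Fin N) ℂ} {v : EuclideanSpace ℂ (Fin N)}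

lemma star_dotProduct_self_of_norm_eq_one (hv : ‖v‖ = 1) : star v.ofLp ⬝ᵥ v.ofLp = 1 := by
  rw [star_dotProduct_self_eq_norm_sq, WithLp.toLp_ofLp, hv]
  simp

lemma norm_omega1 (U : Matrix (Fin N) (Fin N) ℂ) (v : EuclideanSpace ℂ (Fin N)) :
    ‖omega1 U v‖ = √N * ‖star v.ofLp ⬝ᵥ (Uᴴ *ᵥ v.ofLp)‖ := by
  rw [omega1, norm_mul, Complex.norm_real, Real.norm_of_nonneg (Real.sqrt_nonneg _)]

lemma natCast_rpow_neg_half_add (hN : 1 ≤ N) (a : ℝ) :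
    (N : ℝ) ^ (-(1 / 2 : ℝ) + a) = (N : ℝ) ^ a / √N := by
  have hN' : (0 : ℝ) < N := by exact_mod_cast hN
  rw [Real.rpow_add hN', Real.rpow_neg hN'.le, ← Real.sqrt_eq_rpow, mul_comm, div_eq_mul_inv]

/-- Both `√N |w|` and `√N |𝒲₂(z)|` are at most `N ^ (α - ε/2)`. Doubling their sum gives `4 N ^ α N
^ (-ε/2)`, below `N ^ α` once `N ^ (-ε/2) < 1/4`. -/
lemma not_isRoot_charpoly_G_of_regular (hN : 1 ≤ N) (hU : U ∈ Matrix.unitaryGroup (Fin N) ℂ)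
    (hv : ‖v‖ = 1) {α ε : ℝ} (hα : ε < α) (hsmall : (N : ℝ) ^ (-(ε / 2)) < 1 / 4)
    (hω : ‖omega1 U v‖ < (N : ℝ) ^ (ε / 2)) {t : ℝ} (ht : (N : ℝ) ^ (-(1 / 2 : ℝ) + α) < |t|)
    (ht1 : |t| ≤ 1) {z : ℂ} (hz : ‖z‖ < 1 - (N : ℝ) ^ (-α + ε))
    (hW : ‖W2 U v z‖ ≤ (N : ℝ) ^ (ε / 2) * (‖z‖ ^ 2 / (√N * (1 - ‖z‖)))) :
    ¬ (G U v t).charpoly.IsRoot z := by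
  have hN' : (0 : ℝ) < N := by exact_mod_cast hN
  have hs : 0 < √(N : ℝ) := Real.sqrt_pos.2 hN'
  have hgap : 0 < (N : ℝ) ^ (-α + ε) := Real.rpow_pos_of_pos hN' _
  have hz1 : ‖z‖ < 1 := by linarith
  refine not_isRoot_charpoly_G hU (star_dotProduct_self_of_norm_eq_one hv) ht1 hz1 ?_
  refine lt_of_le_of_lt ?_ ht
  rw [natCast_rpow_neg_half_add hN, le_div_iff₀ hs]
  rw [norm_omega1] at hω
  set w := ‖star v.ofLp ⬝ᵥ (Uᴴ *ᵥ v.ofLp)‖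
  have hu : (N : ℝ) ^ (ε / 2) ≤ (N : ℝ) ^ (α - ε / 2) :=
    Real.rpow_le_rpow_of_exponent_le (by exact_mod_cast hN) (by linarith)
  have h1 : (N : ℝ) ^ (α - ε / 2) = (N : ℝ) ^ α * (N : ℝ) ^ (-(ε / 2)) := by
    rw [← Real.rpow_add hN', sub_eq_add_neg]
  have h2 : (N : ℝ) ^ (α - ε / 2) * (N : ℝ) ^ (-α + ε) = (N : ℝ) ^ (ε / 2) := by
    rw [← Real.rpow_add hN']; congr 1; ring
  have hNα : 0 < (N : ℝ) ^ α := Real.rpow_pos_of_pos hN' _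
  have hWN : ‖W2 U v z‖ * √N ≤ (N : ℝ) ^ (α - ε / 2) := by
    have h3 : 0 < 1 - ‖z‖ := by linarith
    have h4 : (N : ℝ) ^ (ε / 2) * (‖z‖ ^ 2 / (√N * (1 - ‖z‖))) * √N =
        (N : ℝ) ^ (ε / 2) * ‖z‖ ^ 2 / (1 - ‖z‖) := by field_simp
    refine (mul_le_mul_of_nonneg_right hW hs.le).trans ?_
    rw [h4, div_le_iff₀ h3]
    have h5 : ‖z‖ ^ 2 ≤ 1 := pow_le_one₀ (norm_nonneg _) hz1.le
    have h6 : 0 < (N : ℝ) ^ (ε / 2) := Real.rpow_pos_of_pos hN' _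
    have h7 : 0 < (N : ℝ) ^ (α - ε / 2) := Real.rpow_pos_of_pos hN' _
    calc (N : ℝ) ^ (ε / 2) * ‖z‖ ^ 2 ≤ (N : ℝ) ^ (ε / 2) := mul_le_of_le_one_right h6.le h5
      _ = (N : ℝ) ^ (α - ε / 2) * (N : ℝ) ^ (-α + ε) := h2.symm
      _ ≤ _ := mul_le_mul_of_nonneg_left (by linarith) h7.le
  have h8 := mul_lt_mul_of_pos_left hsmall hNα
  linarith [mul_comm w √N]

lemma eigCount_G_of_regular (hN : 2 ≤ N) (hU : U ∈ Matrix.unitaryGroup (Fin N) ℂ)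
    (hv : ‖v‖ = 1) {α : ℝ} (hsmall : (N : ℝ) ^ (-(α / 16)) < 1 / 2)
    (hω : (N : ℝ) ^ (-(α / 16)) < ‖omega1 U v‖) {t : ℝ} (ht : |t| < (N : ℝ) ^ (-(1 / 2 : ℝ) - α))
    (hW : ∀ z ∈ Metric.ball (0 : ℂ) (1 - (N : ℝ) ^ (-1 : ℝ)),
      ‖W2 U v z‖ ≤ (N : ℝ) ^ (α / 16) * (‖z‖ ^ 2 / (√N * (1 - ‖z‖))))
    {𝒟 : Set ℂ} (h𝒟 : ∀ z, (G U v t).charpoly.IsRoot z → z ∈ 𝒟) :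
    eigCount (G U v t)
        (Metric.ball 0 (1 / 2 * ((N : ℝ) ^ (-(α / 2)) / (1 + (N : ℝ) ^ (-(α / 2)))))) = 1 ∧
      eigCount (G U v t)
        (𝒟 \ Metric.ball 0 (1 / 2 * ((N : ℝ) ^ (-(α / 4)) / (1 + (N : ℝ) ^ (-(α / 4)))))) + 1
          = N := by
  have hN2 : (2 : ℝ) ≤ N := by exact_mod_cast hN
  have hN' : (0 : ℝ) < N := by linarith
  have hs : 1 ≤ √(N : ℝ) := Real.one_le_sqrt.2 (by linarith)
  have hs0 : 0 < √(N : ℝ) := by linarith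
  rw [sub_eq_add_neg, natCast_rpow_neg_half_add (by omega), lt_div_iff₀ hs0] at ht
  rw [norm_omega1] at hω
  -- Every scale is a power of `u < 1/2`: `√N |t| < u^16`, `√N |w| > u`, `r` is of order `u^8` and
  -- `R` of order `u^4`. Then `t` is negligible because `u^16` is far below `u * u^8`, and `𝒲₂`
  -- because `u⁻¹ |z|²` is far below `u |z|` when `|z| ≤ u^4 / 2`.
  set u := (N : ℝ) ^ (-(α / 16)) with hu
  have hu0 : 0 < u := Real.rpow_pos_of_pos hN' _
  have e16 : (N : ℝ) ^ (-α) = u ^ 16 := by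
    rw [hu, ← Real.rpow_natCast, ← Real.rpow_mul hN'.le]; congr 1; push_cast; ring
  have e8 : (N : ℝ) ^ (-(α / 2)) = u ^ 8 := by
    rw [hu, ← Real.rpow_natCast, ← Real.rpow_mul hN'.le]; congr 1; push_cast; ring
  have e4 : (N : ℝ) ^ (-(α / 4)) = u ^ 4 := by
    rw [hu, ← Real.rpow_natCast, ← Real.rpow_mul hN'.le]; congr 1; push_cast; ring
  have e1 : (N : ℝ) ^ (α / 16) = u⁻¹ := by rw [hu, Real.rpow_neg hN'.le, inv_inv]
  rw [e16] at ht
  rw [e8, e4]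
  rw [e1] at hW
  set w := ‖star v.ofLp ⬝ᵥ (Uᴴ *ᵥ v.ofLp)‖ with hw
  have hu2 : u ^ 2 < 1 / 4 := by nlinarith
  have hu4 : u ^ 4 < 1 / 16 := by nlinarith [sq_nonneg u]
  have hu8 : u ^ 8 < u ^ 4 / 16 := by
    have : 0 < u ^ 4 := by positivity
    nlinarith
  have hu16 : u ^ 16 < u * u ^ 8 / 128 := by
    have h7 : u ^ 7 < 1 / 128 := by
      have : u ^ 7 < (1 / 2) ^ 7 := pow_lt_pow_left₀ hsmall hu0.le (by norm_num)
      norm_num at this ⊢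
      exact this
    have : u ^ 16 = u * u ^ 8 * u ^ 7 := by ring
    rw [this]
    nlinarith [(by positivity : 0 < u * u ^ 8)]
  have hr_low : u ^ 8 / 4 ≤ 1 / 2 * (u ^ 8 / (1 + u ^ 8)) := by
    have : u ^ 8 / 2 ≤ u ^ 8 / (1 + u ^ 8) :=
      div_le_div_of_nonneg_left (by positivity) (by positivity) (by linarith)
    linarith
  have hr_upp : 1 / 2 * (u ^ 8 / (1 + u ^ 8)) ≤ u ^ 8 / 2 := by
    have : u ^ 8 / (1 + u ^ 8) ≤ u ^ 8 := div_le_self (by positivity) (by linarith [pow_pos hu0 8])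
    linarith
  have hR_low : u ^ 4 / 4 ≤ 1 / 2 * (u ^ 4 / (1 + u ^ 4)) := by
    have : u ^ 4 / 2 ≤ u ^ 4 / (1 + u ^ 4) :=
      div_le_div_of_nonneg_left (by positivity) (by positivity) (by linarith)
    linarith
  have hR_upp : 1 / 2 * (u ^ 4 / (1 + u ^ 4)) ≤ u ^ 4 / 2 := by
    have : u ^ 4 / (1 + u ^ 4) ≤ u ^ 4 := div_le_self (by positivity) (by linarith [pow_pos hu0 4])
    linarith
  have hw0 : 0 < w := pos_of_mul_pos_right (hu0.trans hω) hs0.le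
  have ht0 := abs_nonneg t
  have ht' : |t| ≤ |t| * √N := le_mul_of_one_le_right ht0 hs
  refine eigCount_G_of_annulus hU (star_dotProduct_self_of_norm_eq_one hv) ?_ (by positivity)
    (by linarith [pow_pos hu0 4]) (by linarith) (norm_pos_iff.1 hw0) ?_ (fun z hz => ?_) h𝒟
  · have : u * u ^ 8 ≤ 1 := mul_le_one₀ (by linarith) (by positivity) (by linarith)
    linarith
  · refine le_trans ?_ (mul_le_mul_of_nonneg_left hr_low hw0.le)
    refine le_of_mul_le_mul_right ?_ hs0
    have : u * (u ^ 8 / 4) ≤ √N * w * (u ^ 8 / 4) :=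
      mul_le_mul_of_nonneg_right hω.le (by positivity)
    linarith
  · have hzu : ‖z‖ ≤ u ^ 4 / 2 := hz.trans hR_upp
    have hinv : (N : ℝ) ^ (-1 : ℝ) ≤ 1 / 2 := by
      rw [Real.rpow_neg_one, one_div]
      exact inv_anti₀ two_pos hN2
    have h1 := hW z (by rw [mem_ball_zero_iff]; linarith)
    refine h1.trans ?_
    have h2 : ‖z‖ ^ 2 / (√N * (1 - ‖z‖)) ≤ 2 * ‖z‖ ^ 2 / √N := by
      rw [div_le_div_iff₀ (mul_pos hs0 (by linarith)) hs0]
      have : 0 ≤ ‖z‖ ^ 2 * √N := by positivity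
      nlinarith
    refine (mul_le_mul_of_nonneg_left h2 (by positivity)).trans ?_
    have h3 : u⁻¹ * (2 * ‖z‖ ^ 2 / √N) = 2 * ‖z‖ ^ 2 / (u * √N) := by field_simp
    rw [h3, div_le_iff₀ (by positivity)]
    have h4 : 8 * ‖z‖ ≤ u ^ 2 := by nlinarith [sq_nonneg u]
    have h5 : u * u ≤ √N * w * u := mul_le_mul_of_nonneg_right hω.le hu0.le
    have h6 := mul_le_mul_of_nonneg_right (h4.trans (by linarith [sq u] : u ^ 2 ≤ √N * w * u))
      (norm_nonneg z)
    linarith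

end Deterministic

/-! ### Transfer to the random model. -/

section Model

variable {Ω : ℕ → Type*} [∀ N, MeasurableSpace (Ω N)] {P : ∀ N, Measure (Ω N)}
  {U : ∀ N, Ω N → Matrix (Fin N) (Fin N) ℂ} {v : ∀ N, Ω N → EuclideanSpace ℂ (Fin N)}

lemma RegularW2.withHighProb (hW2 : RegularW2 P U v) {δ ε : ℝ} (hδ : 0 < δ) (hε : 0 < ε) :
    WithHighProb P (fun N => {ω | ∀ z ∈ Metric.ball (0 : ℂ) (1 - (N : ℝ) ^ (-δ)),
      ‖W2 (U N ω) (v N ω) z‖ ≤ (N : ℝ) ^ ε * (‖z‖ ^ 2 / (√N * (1 - ‖z‖)))}) := by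
  refine (hW2 δ hδ ε hε).withHighProb.mono ?_
  filter_upwards with N ω hω z hz
  have h := hω z hz
  rwa [Complex.norm_real, Real.norm_of_nonneg] at h
  have : ‖z‖ < 1 - (N : ℝ) ^ (-δ) := by simpa using hz
  have : 0 ≤ (N : ℝ) ^ (-δ) := by positivity
  have : 0 ≤ 1 - ‖z‖ := by linarith
  positivity

/-- The events used do not depend on `t`, hence uniformity in `t`. The pair `F`, `𝒟` lets one
argument serve both the closed and the open disc. -/
lemma stronglySeparatedOutlierAtOrigin_G (hU : ∀ N ω, U N ω ∈ Matrix.unitaryGroup (Fin N) ℂ)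
    (hv : ∀ N, 1 ≤ N → ∀ ω, ‖v N ω‖ = 1) (hW2 : RegularW2 P U v) (hω1 : RegularOmega1 P U v)
    {α : ℝ} (hα : 0 < α) {F : ∀ N, Set (Ω N)} (hF : WithHighProb P F) {𝒟 : Set ℂ}
    (h𝒟 : ∀ N, 1 ≤ N → ∀ ω ∈ F N, ∀ t : ℝ, |t| < 1 →
      ∀ z, (G (U N ω) (v N ω) t).charpoly.IsRoot z → z ∈ 𝒟) :
    StronglySeparatedOutlierAtOrigin P (fun N ω t => G (U N ω) (v N ω) t)
      (fun N => {t : ℝ | |t| < (N : ℝ) ^ (-(1 / 2 : ℝ) - α)}) 𝒟 := by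
  refine ⟨-(α / 2), -(α / 4), 1 / 2, 1 / 2, by linarith, by linarith, by norm_num, by norm_num,
    by norm_num, by norm_num, ?_⟩
  refine (((hW2.withHighProb one_pos (by positivity : 0 < α / 16)).inter
    (hω1 (α / 16) (by positivity))).inter hF).mono ?_
  filter_upwards [eventually_ge_atTop 2,
    eventually_natCast_rpow_neg_lt (by positivity : 0 < α / 16) (by norm_num : (0 : ℝ) < 1 / 2)]
    with N hN hsmall ω hω t ht
  have ht1 : |t| < 1 := lt_of_lt_of_le ht
    (Real.rpow_le_one_of_one_le_of_nonpos (by exact_mod_cast (by omega : 1 ≤ N)) (by linarith))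
  exact eigCount_G_of_regular hN (hU N ω) (hv N (by omega) ω) hsmall hω.1.2.2 ht hω.1.1
    (h𝒟 N (by omega) ω hω.2 t ht1)

lemma withHighProb_spectrum_G_subset (hU : ∀ N ω, U N ω ∈ Matrix.unitaryGroup (Fin N) ℂ)
    (hv : ∀ N, 1 ≤ N → ∀ ω, ‖v N ω‖ = 1) (hW2 : RegularW2 P U v) (hω1 : RegularOmega1 P U v)
    {α ε : ℝ} (hε : 0 < ε) (hα : ε < α) {F : ∀ N, Set (Ω N)} (hF : WithHighProb P F) {𝒟 : Set ℂ}
    (h𝒟 : ∀ N, 1 ≤ N → ∀ ω ∈ F N, ∀ t : ℝ, |t| < 1 →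
      ∀ z, (G (U N ω) (v N ω) t).charpoly.IsRoot z → z ∈ 𝒟) :
    WithHighProb P (fun N => {ω | ∀ t : ℝ,
      (N : ℝ) ^ (-(1 / 2 : ℝ) + α) < |t| → |t| < 1 →
        spectrum ℂ (G (U N ω) (v N ω) t) ⊆
          𝒟 \ Metric.ball 0 (1 - (N : ℝ) ^ (-α + ε))}) := by
  -- With `δ = α - ε`, the regularity disc of `𝒲₂` is exactly the disc to be kept free of
  -- eigenvalues.
  refine (((hW2.withHighProb (sub_pos.2 hα) (half_pos hε)).inter
    (hω1 (ε / 2) (half_pos hε))).inter hF).mono ?_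
  filter_upwards [eventually_ge_atTop 1,
    eventually_natCast_rpow_neg_lt (half_pos hε) (by norm_num : (0 : ℝ) < 1 / 4)]
    with N hN hsmall ω hω t ht ht1 z hz
  have hroot : (G (U N ω) (v N ω) t).charpoly.IsRoot z :=
    Matrix.mem_spectrum_iff_isRoot_charpoly.1 hz
  refine ⟨h𝒟 N hN ω hω.2 t ht1 z hroot, fun hzb => ?_⟩
  refine not_isRoot_charpoly_G_of_regular hN (hU N ω) (hv N hN ω) hα hsmall hω.1.2.1 ht ht1.le
    (mem_ball_zero_iff.1 hzb) (hω.1.1 z ?_) hroot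
  rwa [neg_sub, sub_eq_neg_add ε]

end Model

end UAModel

theorem theorem1 {Ω : ℕ → Type*} [∀ N, MeasurableSpace (Ω N)]
    (P : ∀ N, Measure (Ω N)) [∀ N, IsProbabilityMeasure (P N)]
    (U : ∀ N, Ω N → Matrix (Fin N) (Fin N) ℂ)
    (v : ∀ N, Ω N → EuclideanSpace ℂ (Fin N))
    (hUmeas : ∀ N i j, Measurable (fun ω => U N ω i j))
    (hvmeas : ∀ N, Measurable (v N))
    (hU : ∀ N ω, U N ω ∈ Matrix.unitaryGroup (Fin N) ℂ)
    (hv : ∀ N, 1 ≤ N → ∀ ω, ‖v N ω‖ = 1)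
    (hW2 : UAModel.RegularW2 P U v)
    (hω1 : UAModel.RegularOmega1 P U v)
    (α ε : ℝ) (hε : 0 < ε) (hα : ε < α) :
    -- without further assumptions, with the closed unit disc
    (UAModel.StronglySeparatedOutlierAtOrigin P
        (fun N ω t => UAModel.G (U N ω) (v N ω) t)
        (fun N => {t : ℝ | |t| < (N : ℝ) ^ (-(1 / 2 : ℝ) - α)})
        (Metric.closedBall 0 1) ∧
      UAModel.WithHighProb P (fun N => {ω | ∀ t : ℝ,
        (N : ℝ) ^ (-(1 / 2 : ℝ) + α) < |t| → |t| < 1 →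
          spectrum ℂ (UAModel.G (U N ω) (v N ω) t) ⊆
            Metric.closedBall 0 1 \ Metric.ball 0 (1 - (N : ℝ) ^ (-α + ε))})) ∧
    -- with the open unit disc, if w.h.p. no eigenvector of `U` is orthogonal to `v`
    (UAModel.WithHighProb P
        (fun N => {ω | UAModel.NoOrthogonalEigenvector (U N ω) (v N ω)}) →
      UAModel.StronglySeparatedOutlierAtOrigin P
        (fun N ω t => UAModel.G (U N ω) (v N ω) t)
        (fun N => {t : ℝ | |t| < (N : ℝ) ^ (-(1 / 2 : ℝ) - α)})
        (Metric.ball 0 1) ∧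
      UAModel.WithHighProb P (fun N => {ω | ∀ t : ℝ,
        (N : ℝ) ^ (-(1 / 2 : ℝ) + α) < |t| → |t| < 1 →
          spectrum ℂ (UAModel.G (U N ω) (v N ω) t) ⊆
            Metric.ball 0 1 \ Metric.ball 0 (1 - (N : ℝ) ^ (-α + ε))})) := by
  refine ⟨?_, fun hgen => ?_⟩
  · have h𝒟 : ∀ N, 1 ≤ N → ∀ ω ∈ (Set.univ : Set (Ω N)), ∀ t : ℝ, |t| < 1 → ∀ z,
        (UAModel.G (U N ω) (v N ω) t).charpoly.IsRoot z → z ∈ Metric.closedBall (0 : ℂ) 1 :=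
      fun N hN ω _ t ht z hz => UAModel.mem_closedBall_of_isRoot_charpoly_G (hU N ω)
        (UAModel.star_dotProduct_self_of_norm_eq_one (hv N hN ω)) ht.le hz
    exact ⟨UAModel.stronglySeparatedOutlierAtOrigin_G hU hv hW2 hω1 (hε.trans hα)
        UAModel.withHighProb_univ h𝒟,
      UAModel.withHighProb_spectrum_G_subset hU hv hW2 hω1 hε hα UAModel.withHighProb_univ h𝒟⟩
  · have h𝒟 : ∀ N, 1 ≤ N → ∀ ω ∈ {ω | UAModel.NoOrthogonalEigenvector (U N ω) (v N ω)},
        ∀ t : ℝ, |t| < 1 → ∀ z,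
        (UAModel.G (U N ω) (v N ω) t).charpoly.IsRoot z → z ∈ Metric.ball (0 : ℂ) 1 :=
      fun N hN ω hω t ht z hz => UAModel.mem_ball_of_isRoot_charpoly_G (hU N ω)
        (UAModel.star_dotProduct_self_of_norm_eq_one (hv N hN ω)) hω ht hz
    exact ⟨UAModel.stronglySeparatedOutlierAtOrigin_G hU hv hW2 hω1 (hε.trans hα) hgen h𝒟,
      UAModel.withHighProb_spectrum_G_subset hU hv hW2 hω1 hε hα hgen h𝒟⟩
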